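/- A finite cylindrical electrical network $G$ is a finite weighted undirected multigraph with positive edge weights (conductances) $w(e)$, embedded without crossings into the closed cylinder $(\mathbb{R}/\mathbb{Z})\times[0,1]$, such that the open edges avoid the boundary of the cylinder; the vertices on the boundary of the cylinder are the boundary vertices, the other vertices are interior. Its universal cover $G(\infty)$ is the preimage of $G$ in the strip $\mathbb{R}\times[0,1]$, an infinite periodic network. For a network with finitely many interior vertices and Kirchhoff matrix $K$ (for $i\ne j$, $K_{ij}$ is the total weight of the edges joining $i$ and $j$, and $K_{ii}$ is minus the total weight of the non-loop edges at $i$), the response matrix is the Schur complement $L=K/K_I$, where $I$ is the set of interior vertices. For a finite set $S$ of vertices of $G(\infty)$, the truncation $G_S$ consists of the edges of $G(\infty)$ incident to a vertex of $S$, and its interior vertices are the interior vertices of $G(\infty)$ lying in $S$. Assume that no finite connected component of $G(\infty)$ consists of interior vertices only (so that all the matrices $L(G_S)$ are defined). Then for all boundary vertices $i,j$ of $G(\infty)$ the limit $\mathcal{L}_{ij}=\lim_{N\to\infty}L_{ij}(G_{S_N})$ exists for every increasing sequence $S_1\subset S_2\subset\cdots$ of finite vertex sets that together cover all vertices of $G(\infty)$,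 and does not depend on the sequence; $\mathcal{L}=(\mathcal{L}_{ij})$ is the universal response matrix of $G$. Order the boundary vertices of $G(\infty)$ by traversing the side $\mathbb{R}\times\{0\}$ in increasing direction and then the side $\mathbb{R}\times\{1\}$ in decreasing direction. (If the boundary vertices are numbered in increasing direction by $\mathbb{Z}$ on the first side and by $\mathbb{Z}'$ on the second side, this is the order $\cdots<-1<0<1<2<\cdots<2'<1'<0'<-1'<\cdots$.) Call a pair $(I,J)$ of sequences $I=(i_1,\dots,i_k)$, $J=(j_1,\dots,j_k)$ of boundary vertices a cylindrical pair if some cyclic permutation of $i_1,\dots,i_k,j_k,\dots,j_1$ is strictly increasing. Then $\mathcal{L}$ is cylindrically totally nonnegative: $\det(\mathcal{L}_{i_a j_b})_{a,b=1}^{k}\ge 0$ for every cylindrical pair $(I,J)$. -/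

import Mathlib

open Set Filter Topology

noncomputable section

/-- An electrical network: an undirected weighted multigraph with vertex set `V` and edge set `E`,
positive conductances, and a set of boundary vertices; the other vertices are interior.
Loops and parallel edges are allowed. The type of vertices may be infinite, so that the universal
cover of a network is a network too. -/
structure ElectricalNetwork (V E : Type*) where
  /-- the unordered pair of end points of an edge -/
  ends : E → Sym2 V
  /-- the conductance of an edge -/
  weight : E → ℝ
  weight_pos : ∀ e, 0 < weight e
  /-- the boundary vertices -/
  boundary : Set V

namespace ElectricalNetwork

variable {V E : Type*} (N : ElectricalNetwork V E)

/-- The interior vertices. -/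
def interior : Set V := N.boundaryᶜ

open Classical in
/-- The Kirchhoff matrix. Off the diagonal: the total conductance of the edges joining `i` and `j`.
On the diagonal: minus the total conductance of the edges joining `i` to another vertex (no current
flows along a loop). The sums have finitely many terms when the network is locally finite. -/
def kirchhoff : Matrix V V ℝ := fun i j =>
  if i = j then -∑ᶠ (e : E) (_ : i ∈ N.ends e ∧ ¬ (N.ends e).IsDiag), N.weight e
  else ∑ᶠ (e : E) (_ : N.ends e = s(i, j)), N.weight e

open Classical in
/-- The response matrix of a network with finitely many interior vertices: the Schur complement
`K / K_I`, where `I` is the set of interior vertices. -/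
def response [Fintype N.interior] : Matrix N.boundary N.boundary ℝ :=
  let KBB : Matrix N.boundary N.boundary ℝ := N.kirchhoff.submatrix (↑) (↑)
  let KBI : Matrix N.boundary N.interior ℝ := N.kirchhoff.submatrix (↑) (↑)
  let KIB : Matrix N.interior N.boundary ℝ := N.kirchhoff.submatrix (↑) (↑)
  let KII : Matrix N.interior N.interior ℝ := N.kirchhoff.submatrix (↑) (↑)
  KBB - KBI * KII⁻¹ * KIB

/-- Every nonempty finite set of interior vertices is joined by an edge to a vertex outside it;
that is, no finite connected component consists of interior vertices only. This is what
makes the Schur complements that define the response matrices of all truncations exist. -/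
def Grounded : Prop :=
  ∀ S : Finset V, S.Nonempty → (∀ v ∈ S, v ∈ N.interior) →
    ∃ e : E, ∃ u v : V, N.ends e = s(u, v) ∧ u ∈ S ∧ v ∉ S

/-- The truncation of a network at a finite set `S` of vertices: its edges are the edges incident
to a vertex of `S`, and a vertex is interior in the truncation if it lies in `S` and is
interior in `N`. (Vertices that meet none of these edges are kept, as isolated boundary
vertices.) -/
def truncation (S : Finset V) : ElectricalNetwork V {e : E // ∃ v ∈ S, v ∈ N.ends e} where
  ends e := N.ends e
  weight e := N.weight e
  weight_pos e := N.weight_pos e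
  boundary := {v | v ∉ S ∨ v ∈ N.boundary}

theorem finite_interior_truncation (S : Finset V) : (N.truncation S).interior.Finite :=
  S.finite_toSet.subset fun v hv => by
    by_contra h
    exact hv (Or.inl h)

instance fintypeInteriorTruncation (S : Finset V) : Fintype (N.truncation S).interior :=
  (N.finite_interior_truncation S).fintype

/-- The response matrix of the truncation at `S`, restricted to the boundary vertices of `N`
(which are boundary vertices of every truncation). -/
def truncatedResponse (S : Finset V) : Matrix N.boundary N.boundary ℝ := fun i j =>
  (N.truncation S).response ⟨i, Or.inr i.2⟩ ⟨j, Or.inr j.2⟩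

/-- The entrywise limit of the response matrices of the truncations, as the finite
set of vertices grows to the whole vertex set. -/
def limitResponse : Matrix N.boundary N.boundary ℝ := fun i j =>
  limUnder atTop fun S : Finset V => N.truncatedResponse S i j

end ElectricalNetwork

/-- The closed cylinder. -/
abbrev Cylinder : Type := UnitAddCircle × unitInterval

/-- The infinite strip, which is the universal cover of the cylinder. -/
abbrev Strip : Type := ℝ × unitInterval

/-- The covering map from the strip to the cylinder. -/
def stripProj (x : Strip) : Cylinder := ((x.1 : UnitAddCircle), x.2)

/-- A cylindrical electrical network with vertex set `V` and edge set `E`: a weighted multigraph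
embedded into the cylinder (vertices are distinct points, edges are arcs whose relative interiors
are simple, pairwise disjoint, and disjoint from the vertices), such that the open arcs do not meet
the boundary of the cylinder. The boundary vertices are the vertices that lie on the boundary of the
cylinder. -/
structure CylindricalNetwork (V E : Type*) where
  /-- the position of a vertex -/
  pos : V → Cylinder
  pos_injective : Function.Injective pos
  /-- the end points of an edge, in an arbitrary order -/
  source : E → V
  target : E → V
  /-- the arc that represents an edge -/
  arc : E → C(unitInterval, Cylinder)
  arc_zero : ∀ e, arc e 0 = pos (source e)
  arc_one : ∀ e, arc e 1 = pos (target e)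
  arc_injOn : ∀ e, Set.InjOn (arc e) (Set.Ioo 0 1)
  arc_ne_pos : ∀ e, ∀ t ∈ Set.Ioo (0 : unitInterval) 1, ∀ v, arc e t ≠ pos v
  arc_disjoint : ∀ e e', e ≠ e' → ∀ s ∈ Set.Ioo (0 : unitInterval) 1,
    ∀ t ∈ Set.Ioo (0 : unitInterval) 1, arc e s ≠ arc e' t
  arc_interior : ∀ e, ∀ t ∈ Set.Ioo (0 : unitInterval) 1, (arc e t).2 ∈ Set.Ioo (0 : unitInterval) 1
  /-- the conductance of an edge -/
  weight : E → ℝ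
  weight_pos : ∀ e, 0 < weight e

namespace CylindricalNetwork

variable {V E : Type*} (G : CylindricalNetwork V E)

/-- The vertices of the universal cover: the points of the strip that lie over a vertex. -/
def CoverVertex : Type := {x : Strip // stripProj x ∈ Set.range G.pos}

/-- The edges of the universal cover: the lifts to the strip of the arcs of the network. -/
def CoverEdge : Type _ :=
  {p : E × C(unitInterval, Strip) // ∀ t, stripProj (p.2 t) = G.arc p.1 t}

/-- The first end point of a lifted edge. -/
def coverSource (e : G.CoverEdge) : G.CoverVertex :=
  ⟨e.1.2 0, G.source e.1.1, by rw [e.2 0, G.arc_zero]⟩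

/-- The second end point of a lifted edge. -/
def coverTarget (e : G.CoverEdge) : G.CoverVertex :=
  ⟨e.1.2 1, G.target e.1.1, by rw [e.2 1, G.arc_one]⟩

/-- The universal cover `G(∞)`: an infinite periodic network embedded into the strip. -/
def cover : ElectricalNetwork G.CoverVertex G.CoverEdge where
  ends e := s(G.coverSource e, G.coverTarget e)
  weight e := G.weight e.1.1
  weight_pos e := G.weight_pos e.1.1
  boundary := {x | x.1.2 = 0 ∨ x.1.2 = 1}

/-- The universal response matrix, with rows and columns indexed by the boundary vertices of
the universal cover. -/
def universalResponse : Matrix G.cover.boundary G.cover.boundary ℝ := G.cover.limitResponse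

/-- The total order in which the boundary of the strip is traversed: along one side in
the increasing direction, then along the other side in the decreasing direction. When the boundary
vertices of the universal cover are numbered in increasing direction by `ℤ` on the first side and by
`ℤ'` on the second side, this is the order `⋯ < -1 < 0 < 1 < 2 < ⋯ < 2' < 1' < 0' < -1' < ⋯`. -/
def BoundaryBefore (x y : G.cover.boundary) : Prop :=
  (x.1.1.2 = 0 ∧ y.1.1.2 = 0 ∧ x.1.1.1 < y.1.1.1) ∨
  (x.1.1.2 = 0 ∧ y.1.1.2 = 1) ∨
  (x.1.1.2 = 1 ∧ y.1.1.2 = 1 ∧ y.1.1.1 < x.1.1.1)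

end CylindricalNetwork

/-- `(I, J)`, where `I = (i₁, …, iₖ)` and `J = (j₁, …, jₖ)`, is a cylindrical pair if some cyclic
permutation of `i₁, …, iₖ, jₖ, …, j₁` is in (strictly increasing) order. -/
def IsCylindricalPair {ι : Type*} [LinearOrder ι] {k : ℕ} (I J : Fin k → ι) : Prop :=
  ∃ l : List ι, l.IsRotated (List.ofFn I ++ (List.ofFn J).reverse) ∧ l.Pairwise (· < ·)

/-- A matrix with linearly ordered labels (in the case of interest, labels in `ℤ ∪ ℤ'`) is
cylindrically totally nonnegative if its minors indexed by cylindrical pairs are nonnegative. -/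
def IsCylindricallyTNN {ι : Type*} [LinearOrder ι] (M : Matrix ι ι ℝ) : Prop :=
  ∀ (k : ℕ) (I J : Fin k → ι), IsCylindricalPair I J → 0 ≤ (M.submatrix I J).det

end

/-!
The response matrix is compared with harmonic functions on the one hand, and with systems of
disjoint paths on the other.

*Existence of the limit.* The column of the response matrix of a truncation at a boundary vertex `j`
is read off from the potential in the truncation, the solution of the Dirichlet problem with value
one at `j` and zero at the other boundary vertices. By the minimum principle
(`LocallyFinite.nonneg_of_superharmonic`), which uses only that every finite set of interior vertices
has an edge leaving it, the potential lies between zero and one and increases with the truncation.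
As the universal cover is locally finite, the entries of the response matrices converge along the
directed set of all finite sets of vertices (`LocallyFinite.tendsto_truncatedResponse`), hence along
every exhausting sequence.

*Minors.* Minors of the response matrix of a network with finitely many interior vertices are, up to
a positive factor, determinants of a transfer matrix of which the minor is a Schur complement. Each
row of that matrix is a nonnegative combination of rows with a single outgoing arrow, so by
multilinearity the determinant is a nonnegative combination of determinants attached to successor
functions `φ` (`det_sum_arrowRow_nonneg`); these are directed versions of the groves in the
all-minors matrix-tree theorem. For a single `φ`, column operations reduce the determinant to that of
the zero-one matrix recording which row label flows into which column label
(`det_arrowRow_nonneg`). Flows into different sinks run through disjoint sets of vertices. If no two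
disjoint paths connect row labels to column labels in crossing order, only the identity permutation
contributes to that determinant, and it is nonnegative.

*Planarity.* Disjoint sets of vertices of the universal cover, together with the edges between them,
occupy disjoint parts of the strip (`disjoint_region`), and two paths in the strip whose end points
separate each other on the boundary meet (`not_disjoint_of_crossing`). The latter is a winding number
argument: for disjoint paths `f` and `g` the function `f s - g t` on the square of parameters would
have a continuous logarithm, but its argument changes by `-2π` along the boundary of the square. In a
cylindrical pair, labels that are connected in crossing order separate each other, so no such disjoint
paths exist. This applies to every truncation, and the minors of the limit are limits of minors.
-/

/-! ### Determinants of transfer matrices -/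

/-- A weakly diagonally dominant matrix with nonnegative diagonal has nonnegative determinant: on
the segment from the identity to the matrix the determinant does not vanish before the end point,
by strict dominance. -/
theorem Matrix.det_nonneg_of_weakly_dominant {n : Type*} [Fintype n] [DecidableEq n]
    (A : Matrix n n ℝ) (h : ∀ i, ∑ j ∈ Finset.univ.erase i, |A i j| ≤ A i i) : 0 ≤ A.det := by
  let B : ℝ → Matrix n n ℝ := fun s => (1 - s) • (1 : Matrix n n ℝ) + s • A
  have hcont : Continuous fun s => (B s).det := by
    refine Continuous.matrix_det ?_
    fun_prop
  have hne : ∀ s ∈ Ico (0 : ℝ) 1, (B s).det ≠ 0 := by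
    intro s hs
    refine det_ne_zero_of_sum_row_lt_diag fun i => ?_
    have h1 : ∑ j ∈ Finset.univ.erase i, ‖B s i j‖ = s * ∑ j ∈ Finset.univ.erase i, |A i j| := by
      rw [Finset.mul_sum]
      refine Finset.sum_congr rfl fun j hj => ?_
      have hij : i ≠ j := (Finset.ne_of_mem_erase hj).symm
      simp [B, Matrix.one_apply_ne hij, abs_of_nonneg hs.1]
    have h2 : B s i i = (1 - s) + s * A i i := by simp [B]
    have h3 : s * ∑ j ∈ Finset.univ.erase i, |A i j| ≤ s * A i i :=
      mul_le_mul_of_nonneg_left (h i) hs.1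
    rw [h1, h2, Real.norm_eq_abs]
    exact lt_of_lt_of_le (by linarith [hs.2]) (le_abs_self _)
  have hpos : ∀ s ∈ Ico (0 : ℝ) 1, 0 < (B s).det := by
    intro s hs
    by_contra hneg
    have h0 : (B 0).det = 1 := by simp [B]
    have : (0 : ℝ) ∈ (fun s => (B s).det) '' Icc 0 s :=
      intermediate_value_Icc' hs.1 hcont.continuousOn ⟨not_lt.1 hneg, by simp [h0]⟩
    obtain ⟨t, ht, ht0⟩ := this
    exact hne t ⟨ht.1, ht.2.trans_lt hs.2⟩ ht0
  have hB1 : B 1 = A := by simp [B]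
  have hlim : Tendsto (fun s => (B s).det) (𝓝[<] 1) (𝓝 A.det) := by
    have := (hcont.tendsto 1).mono_left (nhdsWithin_le_nhds (s := Iio 1))
    simpa only [hB1] using this
  refine ge_of_tendsto hlim ?_
  filter_upwards [Ioo_mem_nhdsLT (zero_lt_one' ℝ)] with s hs
  exact (hpos s ⟨hs.1.le, hs.2⟩).le

/-- A permutation of `Fin k` without inversions is the identity. -/
theorem Equiv.Perm.eq_one_of_forall_lt {k : ℕ} (σ : Equiv.Perm (Fin k))
    (h : ∀ a b, a < b → σ a < σ b) : σ = 1 := by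
  have hs : StrictMono σ := fun a b => h a b
  have := Subsingleton.elim (hs.orderIsoOfSurjective σ σ.surjective) (OrderIso.refl (Fin k))
  ext a
  exact congrArg Fin.val (DFunLike.congr_fun this a)

/-- A nonnegative matrix whose support contains no two entries in anti-diagonal position has
nonnegative determinant: only the identity contributes to the Leibniz formula. -/
theorem Matrix.det_nonneg_of_no_crossing {k : ℕ} (P : Matrix (Fin k) (Fin k) ℝ)
    (h0 : ∀ a b, 0 ≤ P a b) (h : ∀ a b c d, a < b → d < c → P a c ≠ 0 → P b d ≠ 0 → False) :
    0 ≤ P.det := by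
  rw [Matrix.det_apply']
  refine Finset.sum_nonneg fun σ _ => ?_
  by_cases hσ : ∀ b, P (σ b) b ≠ 0
  · have : σ = 1 := by
      refine σ.eq_one_of_forall_lt fun a b hab => ?_
      by_contra hlt
      have hlt' : σ b < σ a :=
        lt_of_le_of_ne (not_lt.1 hlt) fun e => hab.ne' (σ.injective e)
      exact h _ _ _ _ hlt' hab (hσ b) (hσ a)
    subst this
    simpa using Finset.prod_nonneg fun b _ => h0 b b
  · push Not at hσ
    obtain ⟨b, hb⟩ := hσ
    have : ∏ b, P (σ b) b = 0 := Finset.prod_eq_zero (Finset.mem_univ b) hb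
    simp [this]

section FlowsTo

variable {k : ℕ} {T : Type*}

/-- `FlowsTo φ x b`: following the successor function `φ` from `x` leads, through elements of `T`,
to the sink `b`. The sources and the sinks are both labelled by `Fin k`: `Sum.inl a` stands for
the source `a` as an argument of `φ` and for the sink `a` as a value. The value `none` means that
the walk is killed. -/
inductive FlowsTo (φ : Fin k ⊕ T → Option (Fin k ⊕ T)) : Fin k ⊕ T → Fin k → Prop
  | last {x b} : φ x = some (Sum.inl b) → FlowsTo φ x b
  | step {x v b} : φ x = some (Sum.inr v) → FlowsTo φ (Sum.inr v) b → FlowsTo φ x b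

variable {φ : Fin k ⊕ T → Option (Fin k ⊕ T)}

theorem FlowsTo.iff {x : Fin k ⊕ T} {b : Fin k} :
    FlowsTo φ x b ↔
      φ x = some (Sum.inl b) ∨ ∃ v, φ x = some (Sum.inr v) ∧ FlowsTo φ (Sum.inr v) b := by
  constructor
  · rintro (h | ⟨h, h'⟩)
    exacts [Or.inl h, Or.inr ⟨_, h, h'⟩]
  · rintro (h | ⟨v, h, h'⟩)
    exacts [.last h, .step h h']

theorem FlowsTo.unique {x : Fin k ⊕ T} {b c : Fin k} (hb : FlowsTo φ x b) (hc : FlowsTo φ x c) :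
    b = c := by
  induction hb with
  | last h =>
    rcases FlowsTo.iff.1 hc with h' | ⟨v, h', -⟩ <;> rw [h] at h' <;> simp at h'
    exact h'
  | step h _ ih =>
    rcases FlowsTo.iff.1 hc with h' | ⟨v, h', h''⟩ <;> rw [h] at h' <;> simp at h'
    subst h'
    exact ih h''

variable [Fintype T] [DecidableEq T]

/-- The unit vector at an optional index; it is zero at `none`. -/
def optionSingle {n : Type*} [DecidableEq n] : Option n → n → ℝ
  | none => 0
  | some y => Pi.single y 1

/-- The rows of a transfer matrix in which every source and every element of `T` has a single
outgoing arrow, given by `φ`. -/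
def arrowRow : Fin k ⊕ T → Option (Fin k ⊕ T) → Fin k ⊕ T → ℝ
  | Sum.inl _, o => optionSingle o
  | Sum.inr v, o => Pi.single (Sum.inr v) 1 - optionSingle o

open Classical in
/-- The determinant for a single successor function. Column operations that add to the column of
a sink the columns of all elements of `T` flowing into it make the matrix block triangular. -/
theorem det_arrowRow_nonneg (φ : Fin k ⊕ T → Option (Fin k ⊕ T))
    (h : ∀ a b c d : Fin k, a < b → d < c →
      FlowsTo φ (Sum.inl a) c → FlowsTo φ (Sum.inl b) d → False) :
    0 ≤ (Matrix.of fun x => arrowRow x (φ x)).det := by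
  set M : Matrix (Fin k ⊕ T) (Fin k ⊕ T) ℝ := Matrix.of fun x => arrowRow x (φ x) with hM
  let Z : Matrix T (Fin k) ℝ := Matrix.of fun v b => if FlowsTo φ (Sum.inr v) b then 1 else 0
  let U : Matrix (Fin k ⊕ T) (Fin k ⊕ T) ℝ := Matrix.fromBlocks 1 0 Z 1
  have hU : U.det = 1 := by simp [U]
  -- the value of a unit vector on the column of the sink `b`
  have hz : ∀ (x : Fin k ⊕ T) (b : Fin k),
      ∑ y, optionSingle (φ x) y * U y (Sum.inl b) = if FlowsTo φ x b then 1 else 0 := by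
    intro x b
    rcases hx : φ x with _ | (c | v)
    · have : ¬ FlowsTo φ x b := by rw [FlowsTo.iff, hx]; simp
      simp [optionSingle, this]
    · have : FlowsTo φ x b ↔ c = b := by rw [FlowsTo.iff, hx]; simp
      simp [optionSingle, this, U, Pi.single_apply, Matrix.one_apply]
    · have : FlowsTo φ x b ↔ FlowsTo φ (Sum.inr v) b := by
        rw [FlowsTo.iff, hx]; simp
      simp [optionSingle, this, U, Z, Pi.single_apply]
  have key : M * U = Matrix.fromBlocks
      (Matrix.of fun a b => if FlowsTo φ (Sum.inl a) b then (1 : ℝ) else 0) M.toBlocks₁₂ 0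
      M.toBlocks₂₂ := by
    ext x y
    rcases y with b | u
    · rcases x with a | v
      · simpa [Matrix.mul_apply, hM, arrowRow] using hz (Sum.inl a) b
      · have := hz (Sum.inr v) b
        simp only [Matrix.mul_apply, hM, arrowRow, Matrix.of_apply, Pi.sub_apply, sub_mul,
          Finset.sum_sub_distrib, this, Matrix.fromBlocks_apply₂₁, Matrix.zero_apply]
        simp [Pi.single_apply, U, Z]
    · rcases x with a | v <;> simp [Matrix.mul_apply, U, Matrix.toBlocks₁₂, Matrix.toBlocks₂₂,
        Matrix.one_apply]
  have hdet : M.det = (M * U).det := by rw [Matrix.det_mul, hU, mul_one]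
  rw [hdet, key, Matrix.det_fromBlocks_zero₂₁]
  refine mul_nonneg (Matrix.det_nonneg_of_no_crossing _ ?_ ?_) ?_
  · intro a b
    simp only [Matrix.of_apply]
    split_ifs <;> simp
  · intro a b c d hab hdc hac hbd
    simp only [Matrix.of_apply, ne_eq, ite_eq_right_iff, one_ne_zero, imp_false, not_not] at hac hbd
    exact h a b c d hab hdc hac hbd
  · refine Matrix.det_nonneg_of_weakly_dominant _ fun v => ?_
    rcases hv : φ (Sum.inr v) with _ | (c | u)
    · have : ∀ u ∈ Finset.univ.erase v, |M.toBlocks₂₂ v u| = 0 := by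
        intro u hu
        simp [Matrix.toBlocks₂₂, hM, arrowRow, hv, optionSingle, Finset.ne_of_mem_erase hu]
      rw [Finset.sum_eq_zero this]
      simp [Matrix.toBlocks₂₂, hM, arrowRow, hv, optionSingle]
    · have : ∀ u ∈ Finset.univ.erase v, |M.toBlocks₂₂ v u| = 0 := by
        intro u hu
        simp [Matrix.toBlocks₂₂, hM, arrowRow, hv, optionSingle, Finset.ne_of_mem_erase hu]
      rw [Finset.sum_eq_zero this]
      simp [Matrix.toBlocks₂₂, hM, arrowRow, hv, optionSingle]
    · by_cases huv : u = v
      · subst huv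
        have : ∀ w ∈ Finset.univ.erase u, |M.toBlocks₂₂ u w| = 0 := by
          intro w hw
          simp [Matrix.toBlocks₂₂, hM, arrowRow, hv, optionSingle]
        rw [Finset.sum_eq_zero this]
        simp [Matrix.toBlocks₂₂, hM, arrowRow, hv, optionSingle]
      · have : ∀ w ∈ Finset.univ.erase v, |M.toBlocks₂₂ v w| = if w = u then 1 else 0 := by
          intro w hw
          simp only [Matrix.toBlocks₂₂, hM, arrowRow, hv, optionSingle, Matrix.of_apply,
            Pi.sub_apply, Pi.single_apply, Sum.inr.injEq, Finset.ne_of_mem_erase hw, if_false]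
          split_ifs <;> simp
        rw [Finset.sum_congr rfl this]
        simp [Matrix.toBlocks₂₂, hM, arrowRow, hv, optionSingle, Ne.symm huv, huv]

/-- If the arrows of positive weight
allow no two crossing flows, the matrix with rows `∑ o, w x o • arrowRow x o` has nonnegative
determinant. The determinant is expanded into single successor functions by multilinearity in the
rows. -/
theorem det_sum_arrowRow_nonneg (w : Fin k ⊕ T → Option (Fin k ⊕ T) → ℝ) (hw : ∀ x o, 0 ≤ w x o)
    (h : ∀ φ : Fin k ⊕ T → Option (Fin k ⊕ T), (∀ x, 0 < w x (φ x)) →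
      ∀ a b c d : Fin k, a < b → d < c →
        FlowsTo φ (Sum.inl a) c → FlowsTo φ (Sum.inl b) d → False) :
    0 ≤ (Matrix.of fun x => ∑ o, w x o • arrowRow x o).det := by
  have := (Matrix.detRowAlternating (R := ℝ) (n := Fin k ⊕ T)).toMultilinearMap.map_sum
    (fun x o => w x o • arrowRow x o)
  change Matrix.det _ = ∑ φ : Fin k ⊕ T → Option (Fin k ⊕ T), Matrix.det _ at this
  refine this.symm ▸ Finset.sum_nonneg fun φ _ => ?_
  have h1 := (Matrix.detRowAlternating (R := ℝ) (n := Fin k ⊕ T)).toMultilinearMap.map_smul_univ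
    (fun x => w x (φ x)) (fun x => arrowRow x (φ x))
  change Matrix.det _ = _ • Matrix.det _ at h1
  refine h1.symm ▸ ?_
  by_cases hφ : ∀ x, 0 < w x (φ x)
  · exact mul_nonneg (Finset.prod_nonneg fun x _ => hw x _) (det_arrowRow_nonneg φ (h φ hφ))
  · push Not at hφ
    obtain ⟨x, hx⟩ := hφ
    rw [Finset.prod_eq_zero (Finset.mem_univ x) (le_antisymm hx (hw x _)), zero_smul]

end FlowsTo

/-! ### Crossing paths in the strip -/

/-- A continuous nonvanishing function on the plane has a continuous logarithm. -/
theorem exists_continuous_log {h : ℝ × ℝ → ℂ} (hc : Continuous h) (h0 : ∀ p, h p ≠ 0) :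
    ∃ F : ℝ × ℝ → ℂ, Continuous F ∧ ∀ p, Complex.exp (F p) = h p := by
  obtain ⟨F, hF, -⟩ := Complex.isCoveringMap_exp.existsUnique_continuousMap_lifts
    (⟨fun p => ⟨h p, h0 p⟩, by fun_prop⟩ : C(ℝ × ℝ, {z : ℂ // z ≠ 0})) 0 (Complex.log (h 0))
    (Subtype.ext (Complex.exp_log (h0 0)))
  refine ⟨F, F.continuous, fun p => ?_⟩
  exact congrArg Subtype.val (congrFun hF.2 p)

/-- The change of a continuous logarithm along a curve that a rotation by `ω` moves into the slit
plane is computed by the principal argument. -/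
theorem im_log_sub_eq_arg_sub {H z : ℝ → ℂ} (hH : Continuous H) (hz : Continuous z)
    (hexp : ∀ t, Complex.exp (H t) = z t) {ω : ℂ} (hω : ∀ t, ω * z t ∈ Complex.slitPlane) :
    (H 1).im - (H 0).im = (ω * z 1).arg - (ω * z 0).arg := by
  have hlog : Continuous fun t => Complex.log (ω * z t) :=
    continuous_iff_continuousAt.2 fun t =>
      (continuous_const.mul hz).continuousAt.clog (hω t)
  have hne : ∀ t, ω * z t ≠ 0 := fun t => Complex.slitPlane_ne_zero (hω t)
  have hω0 : ω ≠ 0 := left_ne_zero_of_mul (hne 0)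
  have hz0 : ∀ t, z t ≠ 0 := fun t => right_ne_zero_of_mul (hne t)
  have key := Complex.isCoveringMap_exp.eq_of_comp_eq hH
    (g₂ := fun t => Complex.log (ω * z t) + (H 0 - Complex.log (ω * z 0)))
    (hlog.add continuous_const) (funext fun t => Subtype.ext ?_) 0 (by simp)
  · have h1 := congrArg Complex.im (congrFun key 1)
    simp only [Complex.add_im, Complex.sub_im, Complex.log_im] at h1
    linarith
  · change Complex.exp (H t) = Complex.exp _
    rw [Complex.exp_add, Complex.exp_sub, Complex.exp_log (hne t), Complex.exp_log (hne 0),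
      hexp, hexp]
    have := hz0 0
    field_simp

/-- The order in which the boundary of the strip is traversed: along the lower side in the
increasing direction, then along the upper side in the decreasing direction. -/
def StripBefore (x y : Strip) : Prop :=
  (x.2 = 0 ∧ y.2 = 0 ∧ x.1 < y.1) ∨ (x.2 = 0 ∧ y.2 = 1) ∨ (x.2 = 1 ∧ y.2 = 1 ∧ y.1 < x.1)

theorem StripBefore.trans {x y z : Strip} (h : StripBefore x y) (h' : StripBefore y z) :
    StripBefore x z := by
  have h01 : (0 : unitInterval) ≠ 1 := zero_ne_one
  rcases h with ⟨h1, h2, h3⟩ | ⟨h1, h2⟩ | ⟨h1, h2, h3⟩ <;>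
    rcases h' with ⟨h4, h5, h6⟩ | ⟨h4, h5⟩ | ⟨h4, h5, h6⟩
  · exact Or.inl ⟨h1, h5, h3.trans h6⟩
  · exact Or.inr (Or.inl ⟨h1, h5⟩)
  · exact absurd (h2.symm.trans h4) h01
  · exact absurd (h4.symm.trans h2) h01
  · exact absurd (h4.symm.trans h2) h01
  · exact Or.inr (Or.inl ⟨h1, h5⟩)
  · exact absurd (h4.symm.trans h2) h01
  · exact absurd (h4.symm.trans h2) h01
  · exact Or.inr (Or.inr ⟨h1, h5, h6.trans h3⟩)

theorem StripBefore.snd_eq_one {x y : Strip} (h : StripBefore x y) (hx : x.2 = 1) : y.2 = 1 := by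
  rcases h with h | h | h
  · exact absurd (h.1.symm.trans hx) zero_ne_one
  · exact h.2
  · exact h.2.1

namespace Strip

/-- The strip as a part of the complex plane. -/
def toComplex (x : Strip) : ℂ := ⟨x.1, x.2⟩

/-- The rotation that turns the half plane containing the strip and bounded by the side of the
boundary point `q` into the right half plane. -/
noncomputable def rotation (q : Strip) : ℂ :=
  open Classical in if q.2 = 0 then -Complex.I else Complex.I

theorem continuous_toComplex : Continuous toComplex := by
  have : toComplex = fun x : Strip => (x.1 : ℂ) + ((x.2 : ℝ) : ℂ) * Complex.I := by
    funext x
    apply Complex.ext <;> simp [toComplex]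
  rw [this]
  fun_prop

theorem toComplex_injective : Function.Injective toComplex := fun _ _ h =>
  Prod.ext (congrArg Complex.re h) (Subtype.ext (congrArg Complex.im h))

theorem rotation_mul_mem_slitPlane {p q : Strip} (hq : q.2 = 0 ∨ q.2 = 1) (hpq : p ≠ q) :
    rotation q * (toComplex p - toComplex q) ∈ Complex.slitPlane := by
  have hne : p.1 - q.1 ≠ 0 ∨ ((p.2 : ℝ) - q.2) ≠ 0 := by
    by_contra! h
    exact hpq (Prod.ext (by linarith [h.1]) (Subtype.ext (by linarith [h.2])))
  rw [Complex.mem_slitPlane_iff]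
  rcases hq with hq | hq
  · have h0 : (q.2 : ℝ) = 0 := by rw [hq]; rfl
    have := p.2.2.1
    simp only [rotation, hq, if_true, toComplex]
    rcases hne with h | h
    · right
      simpa [sub_eq_zero, eq_comm] using h
    · left
      rw [h0, sub_zero] at h
      simpa using lt_of_le_of_ne this h.symm
  · have h0 : (q.2 : ℝ) = 1 := by rw [hq]; rfl
    have := p.2.2.2
    simp only [rotation, hq, one_ne_zero, if_false, toComplex]
    rcases hne with h | h
    · right
      simpa using h
    · left
      have : (p.2 : ℝ) < 1 := lt_of_le_of_ne this fun e => h (by rw [e, h0, sub_self])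
      simpa using this

/-- The jump, at a corner of the parameter square, between the branches of the argument of
`x - y` used on the two adjacent sides. -/
noncomputable def cornerJump (x y : Strip) : ℝ :=
  (rotation y * (toComplex x - toComplex y)).arg - (rotation x * (toComplex y - toComplex x)).arg

theorem cornerJump_swap (x y : Strip) : cornerJump y x = -cornerJump x y := by
  simp [cornerJump]

theorem cornerJump_of_before {x y : Strip} (h : StripBefore x y) :
    cornerJump x y = open Classical in if x.2 = y.2 then Real.pi else 0 := by
  have key : ∀ r : ℝ, 0 < r → ((r : ℂ) * Complex.I).arg - ((r : ℂ) * -Complex.I).arg = Real.pi := by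
    intro r hr
    rw [Complex.arg_real_mul _ hr, Complex.arg_real_mul _ hr, Complex.arg_I, Complex.arg_neg_I]
    ring
  unfold cornerJump
  rcases h with ⟨hx, hy, hlt⟩ | ⟨hx, hy⟩ | ⟨hx, hy, hlt⟩
  · rw [if_pos (hx.trans hy.symm), ← key (y.1 - x.1) (by linarith)]
    congr 2 <;> apply Complex.ext <;> simp [rotation, toComplex, hx, hy]
  · have hne : x.2 ≠ y.2 := by rw [hx, hy]; exact zero_ne_one
    rw [if_neg hne, sub_eq_zero]
    congr 1
    simp only [rotation, hx, hy, one_ne_zero, if_true, if_false]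
    ring
  · rw [if_pos (hx.trans hy.symm), ← key (x.1 - y.1) (by linarith)]
    congr 2 <;> apply Complex.ext <;> simp [rotation, toComplex, hx, hy]

end Strip

open Strip in
/-- Two paths in the strip whose end points separate each other on the boundary meet. Otherwise
the difference of the two paths, as a function on a square of parameters, has a continuous
logarithm, whereas its argument changes by `-2π` along the boundary of the square. -/
theorem not_disjoint_of_crossing {a b c d : Strip} (hab : StripBefore a b) (hbc : StripBefore b c)
    (hcd : StripBefore c d) {X Y : Set Strip} (hX : JoinedIn X a c) (hY : JoinedIn Y b d) :
    ¬ Disjoint X Y := by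
  intro hdisj
  obtain ⟨γ, hγ⟩ := hX
  obtain ⟨δ, hδ⟩ := hY
  have hf : ∀ s, γ.extend s ∈ X := fun s => hγ _
  have hg : ∀ s, δ.extend s ∈ Y := fun s => hδ _
  have hfc := γ.continuous_extend
  have hgc := δ.continuous_extend
  have hf0 := γ.extend_zero
  have hf1 := γ.extend_one
  have hg0 := δ.extend_zero
  have hg1 := δ.extend_one
  generalize (γ.extend : ℝ → Strip) = f at hf hfc hf0 hf1
  generalize (δ.extend : ℝ → Strip) = g at hg hgc hg0 hg1
  have hne : ∀ s t, f s ≠ g t := fun s t e => disjoint_left.1 hdisj (hf s) (e ▸ hg t)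
  have hfc' : Continuous fun s => toComplex (f s) := continuous_toComplex.comp hfc
  have hgc' : Continuous fun s => toComplex (g s) := continuous_toComplex.comp hgc
  obtain ⟨F, hFc, hF⟩ := exists_continuous_log
    (h := fun p => toComplex (f p.1) - toComplex (g p.2))
    ((hfc'.comp continuous_fst).sub (hgc'.comp continuous_snd))
    fun p => sub_ne_zero.2 fun e => hne p.1 p.2 (toComplex_injective e)
  have ha : a.2 = 0 ∨ a.2 = 1 := by rcases hab with h | h | h <;> simp [h.1]
  have hb : b.2 = 0 ∨ b.2 = 1 := by rcases hbc with h | h | h <;> simp [h.1]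
  have hc : c.2 = 0 ∨ c.2 = 1 := by rcases hcd with h | h | h <;> simp [h.1]
  have hd : d.2 = 0 ∨ d.2 = 1 := by rcases hcd with h | h | h <;> simp [h.2]
  -- the changes of the argument along the sides of the square, where one path stays at `q`; as `q`
  -- lies on the boundary of the strip, the difference stays in a half plane
  have side (t : ℝ) (q : Strip) (hq : q.2 = 0 ∨ q.2 = 1) (hgt : g t = q) :
      (F (1, t)).im - (F (0, t)).im = (rotation q * (toComplex c - toComplex q)).arg -
        (rotation q * (toComplex a - toComplex q)).arg := by
    have := im_log_sub_eq_arg_sub (H := fun s => F (s, t))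
      (z := fun s => toComplex (f s) - toComplex q) (ω := rotation q) (by fun_prop) (by fun_prop)
      (fun s => by rw [hF]; simp [hgt])
      (fun s => rotation_mul_mem_slitPlane hq (hgt ▸ hne s t))
    simpa only [hf0, hf1] using this
  have side' (s : ℝ) (q : Strip) (hq : q.2 = 0 ∨ q.2 = 1) (hfs : f s = q) :
      (F (s, 1)).im - (F (s, 0)).im = (rotation q * (toComplex d - toComplex q)).arg -
        (rotation q * (toComplex b - toComplex q)).arg := by
    have := im_log_sub_eq_arg_sub (H := fun t => F (s, t))
      (z := fun t => toComplex q - toComplex (g t)) (ω := -rotation q) (by fun_prop) (by fun_prop)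
      (fun t => by rw [hF]; simp [hfs])
      (fun t => by
        have := rotation_mul_mem_slitPlane hq (hfs ▸ (hne s t).symm)
        convert this using 1
        ring)
    simp only [hg0, hg1] at this
    rw [this]
    congr 2 <;> ring
  have h1 := side 0 b hb hg0
  have h2 := side 1 d hd hg1
  have h3 := side' 0 a ha hf0
  have h4 := side' 1 c hc hf1
  have hsum : cornerJump c b - cornerJump a b - cornerJump c d + cornerJump a d = 0 := by
    unfold cornerJump
    linarith
  rw [cornerJump_swap, cornerJump_of_before hab, cornerJump_of_before hbc,
    cornerJump_of_before hcd, cornerJump_of_before ((hab.trans hbc).trans hcd)] at hsum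
  have hpi := Real.pi_pos
  have hb' := hab.snd_eq_one
  have hc' := hbc.snd_eq_one
  have hd' := hcd.snd_eq_one
  clear * - hsum ha hb hc hd hb' hc' hd' hpi
  rcases ha with ha | ha <;> rcases hb with hb | hb <;> rcases hc with hc | hc <;>
    rcases hd with hd | hd <;> simp [ha, hb, hc, hd] at hb' hc' hd' hsum <;> linarith

/-! ### Kirchhoff matrices of locally finite networks -/

namespace ElectricalNetwork

variable {V E : Type*} (N : ElectricalNetwork V E)

/-- Every vertex meets finitely many edges. -/
def LocallyFinite : Prop := ∀ v, {e | v ∈ N.ends e}.Finite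

variable {N}

theorem kirchhoff_of_ne {u v : V} (h : u ≠ v) :
    N.kirchhoff u v = ∑ᶠ (e : E) (_ : N.ends e = s(u, v)), N.weight e := by
  rw [kirchhoff, if_neg h]

theorem kirchhoff_nonneg {u v : V} (h : u ≠ v) : 0 ≤ N.kirchhoff u v := by
  rw [kirchhoff_of_ne h]
  exact finsum_nonneg fun e => finsum_nonneg fun _ => (N.weight_pos e).le

theorem exists_edge_of_kirchhoff_ne_zero {u v : V} (h : u ≠ v) (h0 : N.kirchhoff u v ≠ 0) :
    ∃ e, N.ends e = s(u, v) := by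
  by_contra! hne
  exact h0 (by rw [kirchhoff_of_ne h]; simp [hne])

/-- The off-diagonal entries in the row of `u` are supported on a finite set of neighbours, and
the row sums to zero. -/
theorem LocallyFinite.exists_neighbours (hN : N.LocallyFinite) (u : V) :
    ∃ B : Finset V, u ∉ B ∧ (∀ v, v ≠ u → v ∉ B → N.kirchhoff u v = 0) ∧
      ∑ v ∈ B, N.kirchhoff u v = -N.kirchhoff u u := by
  classical
  have hfin : {e | u ∈ N.ends e ∧ ¬ (N.ends e).IsDiag}.Finite :=
    (hN u).subset fun e he => he.1
  -- the end point of an edge at `u` other than `u`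
  let o : E → V := fun e => if h : u ∈ N.ends e then Sym2.Mem.other h else u
  have ho : ∀ e, u ∈ N.ends e → N.ends e = s(u, o e) := fun e he => by
    simp only [o, dif_pos he]
    exact (Sym2.other_spec he).symm
  have hK : ∀ v, v ≠ u →
      N.kirchhoff u v = ∑ e ∈ hfin.toFinset with o e = v, N.weight e := by
    intro v hv
    rw [kirchhoff_of_ne hv.symm]
    rw [← finsum_mem_coe_finset]
    refine finsum_mem_congr (s := {e | N.ends e = s(u, v)}) ?_ fun _ _ => rfl
    ext e
    simp only [Finset.coe_filter, Finite.mem_toFinset, mem_ofPred_eq]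
    constructor
    · intro he
      have hu : u ∈ N.ends e := by simp [he]
      refine ⟨⟨hu, by rw [he]; simpa using hv.symm⟩, ?_⟩
      have := ho e hu
      rw [he] at this
      exact (Sym2.congr_right.1 this).symm
    · rintro ⟨⟨hu, -⟩, rfl⟩
      exact ho e hu
  refine ⟨hfin.toFinset.image o, ?_, ?_, ?_⟩
  · simp only [Finset.mem_image, Finite.mem_toFinset, mem_ofPred_eq, not_exists, not_and]
    rintro e ⟨he, hd⟩ hoe
    rw [ho e he, hoe] at hd
    exact hd rfl
  · intro v hv hB
    rw [hK v hv]
    refine Finset.sum_eq_zero fun e he => ?_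
    rw [Finset.mem_filter] at he
    exact absurd (Finset.mem_image.2 ⟨e, he.1, he.2⟩) hB
  · have hne : ∀ v ∈ hfin.toFinset.image o, v ≠ u := by
      rintro v hv rfl
      simp only [Finset.mem_image, Finite.mem_toFinset, mem_ofPred_eq] at hv
      obtain ⟨e, ⟨he, hd⟩, hoe⟩ := hv
      rw [ho e he, hoe] at hd
      exact hd rfl
    rw [Finset.sum_congr rfl fun v hv => hK v (hne v hv),
      Finset.sum_fiberwise_of_maps_to fun e he => Finset.mem_image_of_mem o he]
    rw [kirchhoff, if_pos rfl, neg_neg]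
    exact (finsum_mem_eq_finite_toFinset_sum _ hfin).symm

theorem LocallyFinite.sum_kirchhoff_le (hN : N.LocallyFinite) {u : V} {W : Finset V}
    (hu : u ∉ W) : ∑ v ∈ W, N.kirchhoff u v ≤ -N.kirchhoff u u := by
  classical
  obtain ⟨B, huB, hB, hsum⟩ := hN.exists_neighbours u
  rw [← hsum]
  calc ∑ v ∈ W, N.kirchhoff u v ≤ ∑ v ∈ W ∪ B, N.kirchhoff u v := by
        refine Finset.sum_le_sum_of_subset_of_nonneg Finset.subset_union_left fun v hv _ => ?_
        refine kirchhoff_nonneg ?_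
        rintro rfl
        exact (Finset.mem_union.1 hv).elim hu huB
    _ = ∑ v ∈ B, N.kirchhoff u v := by
        refine (Finset.sum_subset Finset.subset_union_right fun v hv hvB => ?_).symm
        refine hB v ?_ hvB
        rintro rfl
        exact (Finset.mem_union.1 hv).elim hu huB

theorem LocallyFinite.kirchhoff_pos (hN : N.LocallyFinite) {u v : V} (h : u ≠ v) {e : E}
    (he : N.ends e = s(u, v)) : 0 < N.kirchhoff u v := by
  have hfin : {e | N.ends e = s(u, v)}.Finite := (hN u).subset fun e he => by
    rw [mem_ofPred_eq] at he ⊢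
    rw [he]
    exact Sym2.mem_mk_left u v
  rw [kirchhoff_of_ne h]
  refine lt_of_lt_of_eq ?_ (finsum_mem_eq_finite_toFinset_sum _ hfin).symm
  exact Finset.sum_pos (fun e _ => N.weight_pos e) ⟨e, by simpa using he⟩

/-- The minimum principle: a function on a finite set of interior vertices, extended by zero,
that is superharmonic is nonnegative. -/
theorem LocallyFinite.nonneg_of_superharmonic (hN : N.LocallyFinite) (hG : N.Grounded)
    {T : Finset V} (hT : ∀ v ∈ T, v ∈ N.interior) (x : V → ℝ)
    (hx : ∀ u ∈ T, ∑ v ∈ T, N.kirchhoff u v * x v ≤ 0) : ∀ v ∈ T, 0 ≤ x v := by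
  classical
  by_contra! hneg
  obtain ⟨v₀, hv₀, hv₀neg⟩ := hneg
  obtain ⟨m, hm, hmin⟩ := T.exists_min_image x ⟨v₀, hv₀⟩
  have hmneg : x m < 0 := (hmin v₀ hv₀).trans_lt hv₀neg
  obtain ⟨e, u, y, he, hu, hy⟩ := hG (T.filter fun v => x v = x m)
    ⟨m, by simp [hm]⟩ (fun v hv => hT v (Finset.mem_of_mem_filter v hv))
  obtain ⟨huT, hum⟩ := Finset.mem_filter.1 hu
  have huy : u ≠ y := by rintro rfl; exact hy hu
  let x' : V → ℝ := fun v => if v ∈ T then x v else 0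
  have hxm : ∀ v, x m ≤ x' v := fun v => by
    by_cases hv : v ∈ T
    · simpa [x', hv] using hmin v hv
    · simpa [x', hv] using hmneg.le
  have hym : x m < x' y := by
    by_cases hyT : y ∈ T
    · have : x y ≠ x m := fun h => hy (Finset.mem_filter.2 ⟨hyT, h⟩)
      simpa [x', hyT] using lt_of_le_of_ne (hmin y hyT) this.symm
    · simpa [x', hyT] using hmneg
  have h1 : 0 < ∑ v ∈ (insert y T).erase u, N.kirchhoff u v * (x' v - x m) := by
    refine Finset.sum_pos' (fun v hv => mul_nonneg
      (kirchhoff_nonneg (Finset.ne_of_mem_erase hv).symm) (sub_nonneg.2 (hxm v)))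
      ⟨y, Finset.mem_erase.2 ⟨huy.symm, Finset.mem_insert_self y T⟩, ?_⟩
    exact mul_pos (hN.kirchhoff_pos huy he) (sub_pos.2 hym)
  have h2 : ∑ v ∈ (insert y T).erase u, N.kirchhoff u v * x' v =
      ∑ v ∈ T.erase u, N.kirchhoff u v * x v := by
    rw [← Finset.sum_subset (Finset.erase_subset_erase u (Finset.subset_insert y T))]
    · exact Finset.sum_congr rfl fun v hv => by simp [x', Finset.mem_of_mem_erase hv]
    · intro v hv hvT
      have : v ∉ T := fun h => hvT (Finset.mem_erase.2 ⟨Finset.ne_of_mem_erase hv, h⟩)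
      simp [x', this]
  have h3 := hN.sum_kirchhoff_le (Finset.notMem_erase u (insert y T))
  have h4 := hx u huT
  rw [← Finset.add_sum_erase T _ huT, hum] at h4
  simp only [mul_sub, Finset.sum_sub_distrib, ← Finset.sum_mul, h2] at h1
  nlinarith

/-! ### Response matrices -/

/-- `N.Connects P u v`: there is a path from `u` to `v` all of whose vertices lie in `P`. -/
def Connects (N : ElectricalNetwork V E) (P : Set V) : V → V → Prop :=
  Relation.ReflTransGen fun u v => u ∈ P ∧ v ∈ P ∧ ∃ e, N.ends e = s(u, v)

theorem Connects.symm {P : Set V} {u v : V} (h : N.Connects P u v) : N.Connects P v u :=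
  Relation.ReflTransGen.mono (fun _ _ ⟨h1, h2, e, he⟩ => ⟨h2, h1, e, he.trans Sym2.eq_swap⟩) _ _
    (Relation.ReflTransGen.swap _ _ h)

theorem Connects.left_mem {P : Set V} {u v : V} (h : N.Connects P u v) (huv : u ≠ v) : u ∈ P := by
  rcases Relation.ReflTransGen.cases_head h with rfl | ⟨w, hw, -⟩
  exacts [absurd rfl huv, hw.1]

/-- A flow into the sink `b` traces out a path of the network, when `r` gives the vertex of an argument
of the successor function and `c` that of a value. -/
theorem connects_of_flowsTo {k : ℕ} {T : Type*} {φ : Fin k ⊕ T → Option (Fin k ⊕ T)}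
    {r c : Fin k ⊕ T → V} (hrc : ∀ t, r (Sum.inr t) = c (Sum.inr t))
    (hφ : ∀ x y, φ x = some y → ∃ e, N.ends e = s(r x, c y)) {P : Set V} {b : Fin k}
    (hb : c (Sum.inl b) ∈ P) (hP : ∀ t, FlowsTo φ (Sum.inr t) b → c (Sum.inr t) ∈ P)
    {x : Fin k ⊕ T} (h : FlowsTo φ x b) : r x ∈ P → N.Connects P (r x) (c (Sum.inl b)) := by
  induction h with
  | last h => exact fun hx => .single ⟨hx, hb, hφ _ _ h⟩
  | step h h' ih =>
    intro hx
    have hv := hP _ h'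
    exact .head ⟨hx, hv, hφ _ _ h⟩ (hrc _ ▸ ih hb hP (hrc _ ▸ hv))

section Response

variable [Fintype N.interior]

open Classical in
theorem LocallyFinite.det_interior_ne_zero (hN : N.LocallyFinite) (hG : N.Grounded) :
    (N.kirchhoff.submatrix (↑) (↑) : Matrix N.interior N.interior ℝ).det ≠ 0 := by
  intro h0
  obtain ⟨x, hx0, hx⟩ := Matrix.exists_mulVec_eq_zero_iff.2 h0
  let T : Finset V := N.interior.toFinset
  have hT : ∀ v ∈ T, v ∈ N.interior := fun v hv => by simpa [T] using hv
  let y : V → ℝ := fun v => if h : v ∈ N.interior then x ⟨v, h⟩ else 0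
  have hy : ∀ u ∈ T, ∑ v ∈ T, N.kirchhoff u v * y v = 0 := by
    intro u hu
    have := congrFun hx ⟨u, hT u hu⟩
    rw [Matrix.mulVec, dotProduct] at this
    rw [Finset.sum_subtype T (p := (· ∈ N.interior)) (by simp [T])]
    simpa [y] using this
  have h1 := hN.nonneg_of_superharmonic hG hT y fun u hu => (hy u hu).le
  have h2 := hN.nonneg_of_superharmonic hG hT (fun v => -y v) fun u hu => by
    simp [hy u hu]
  refine hx0 (funext fun v => ?_)
  have hv : (v : V) ∈ T := by simp [T]
  have h3 := h1 v hv
  have h4 := h2 v hv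
  simp only [y, v.2, dif_pos, Subtype.coe_eta] at h3 h4
  exact le_antisymm (neg_nonneg.1 h4) h3

/-- A column of the response matrix in terms of the harmonic function with boundary values one at
`j` and zero elsewhere, which is the solution of a Dirichlet problem. -/
theorem LocallyFinite.exists_potential (hN : N.LocallyFinite) (hG : N.Grounded)
    (j : N.boundary) : ∃ x : V → ℝ, (∀ v, v ∉ N.interior → x v = 0) ∧
      (∀ u ∈ N.interior, ∑ v ∈ N.interior.toFinset, N.kirchhoff u v * x v = -N.kirchhoff u j) ∧
      ∀ i : N.boundary, N.response i j =
        N.kirchhoff i j + ∑ v ∈ N.interior.toFinset, N.kirchhoff i v * x v := by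
  classical
  set A : Matrix N.interior N.interior ℝ := N.kirchhoff.submatrix (↑) (↑)
  have hdet : IsUnit A.det := (hN.det_interior_ne_zero hG).isUnit
  let z : N.interior → ℝ := A⁻¹.mulVec fun v => -N.kirchhoff v j
  let x : V → ℝ := fun v => if h : v ∈ N.interior then z ⟨v, h⟩ else 0
  have hsum : ∀ u, ∑ v ∈ N.interior.toFinset, N.kirchhoff u v * x v =
      ∑ v : N.interior, N.kirchhoff u v * z v := fun u =>
    (Finset.sum_subtype (F := ‹Fintype N.interior›) _ (by simp) _).trans (by simp [x])
  refine ⟨x, fun v hv => dif_neg hv, fun u hu => ?_, fun i => ?_⟩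
  · rw [hsum]
    have : A.mulVec z = fun v : N.interior => -N.kirchhoff v j := by
      simp only [z, Matrix.mulVec_mulVec, Matrix.mul_nonsing_inv _ hdet, Matrix.one_mulVec]
    exact congrFun this ⟨u, hu⟩
  · rw [hsum, response]
    simp only [Matrix.sub_apply, Matrix.submatrix_apply, Matrix.mul_assoc]
    rw [sub_eq_add_neg, Matrix.mul_apply, ← Finset.sum_neg_distrib]
    congr 1
    refine Finset.sum_congr rfl fun v _ => ?_
    simp only [Matrix.submatrix_apply, z, Matrix.mul_apply, Matrix.mulVec, dotProduct, mul_neg,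
      Finset.sum_neg_distrib]
    rfl

/-- A minor of the response matrix is nonnegative if no two vertex-disjoint paths of the network
connect the row labels to the column labels in crossing order. -/
theorem LocallyFinite.det_response_nonneg (hN : N.LocallyFinite) (hG : N.Grounded) {k : ℕ}
    (I J : Fin k → N.boundary) (hI : Function.Injective I) (hJ : Function.Injective J)
    (hIJ : ∀ a b, I a ≠ J b)
    (hcross : ∀ a b c d : Fin k, a < b → d < c → ∀ P Q : Set V, Disjoint P Q →
      N.Connects P (I a) (J c) → N.Connects Q (I b) (J d) → False) :
    0 ≤ (N.response.submatrix I J).det := by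
  classical
  let r : Fin k ⊕ N.interior → V := Sum.elim (fun a => I a) (↑)
  let c : Fin k ⊕ N.interior → V := Sum.elim (fun a => J a) (↑)
  let K := N.kirchhoff
  have hc : Function.Injective c := by
    refine Function.Injective.sumElim (Subtype.val_injective.comp hJ) Subtype.val_injective ?_
    intro a b e
    exact b.2 (e ▸ (J a).2)
  let A : Matrix N.interior N.interior ℝ := K.submatrix (↑) (↑)
  have hAdet : A.det ≠ 0 := hN.det_interior_ne_zero hG
  have hnegA : 0 < (-A).det := by
    have h0 : (-A).det ≠ 0 := by
      rw [Matrix.det_neg]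
      exact mul_ne_zero (pow_ne_zero _ (by norm_num)) hAdet
    refine lt_of_le_of_ne (Matrix.det_nonneg_of_weakly_dominant _ fun u => ?_) h0.symm
    have h1 : ∑ v ∈ Finset.univ.erase u, |(-A) u v| =
        ∑ v ∈ (Finset.univ.erase u).map (Function.Embedding.subtype _), K u v := by
      rw [Finset.sum_map]
      refine Finset.sum_congr rfl fun v hv => ?_
      have : (u : V) ≠ v := fun e => Finset.ne_of_mem_erase hv (Subtype.ext e.symm)
      simpa [A] using abs_of_nonneg (kirchhoff_nonneg this)
    rw [h1]
    exact hN.sum_kirchhoff_le (by simp)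
  -- the transfer matrix whose Schur complement is the minor
  let M : Matrix (Fin k ⊕ N.interior) (Fin k ⊕ N.interior) ℝ := Matrix.fromBlocks
    (K.submatrix (fun a => I a) (fun b => J b)) (K.submatrix (fun a => I a) (↑))
    (-K.submatrix (↑) (fun b => J b)) (-A)
  have hM : M.det = (-A).det * (N.response.submatrix I J).det := by
    have : Invertible (-A) := Matrix.invertibleOfIsUnitDet _ hnegA.ne'.isUnit
    have hinv : ⅟(-A) = -A⁻¹ := by
      refine invOf_eq_right_inv ?_
      rw [neg_mul_neg, Matrix.mul_nonsing_inv _ hAdet.isUnit]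
    simp only [M]
    rw [Matrix.det_fromBlocks₂₂, hinv]
    congr 2
    rw [Matrix.mul_neg, sub_neg_eq_add, Matrix.mul_neg, Matrix.neg_mul, ← sub_eq_add_neg]
    rfl
  suffices h : 0 ≤ M.det by
    rw [hM] at h
    exact nonneg_of_mul_nonneg_right h hnegA
  let w : Fin k ⊕ N.interior → Option (Fin k ⊕ N.interior) → ℝ := fun x o =>
    o.elim (x.elim (fun _ => 0) fun u => -K u u - ∑ y, if (u : V) = c y then 0 else K u (c y))
      fun y => if r x = c y then 0 else K (r x) (c y)
  have hw : ∀ x o, 0 ≤ w x o := by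
    rintro x (_ | y)
    · rcases x with a | u
      · exact le_rfl
      · refine sub_nonneg.2 ?_
        have h1 : ∑ y, (if (u : V) = c y then 0 else K u (c y)) =
            ∑ v ∈ (Finset.univ.filter fun y => (u : V) ≠ c y).map ⟨c, hc⟩, K u v := by
          rw [Finset.sum_map, Finset.sum_filter]
          exact Finset.sum_congr rfl fun y _ => by split_ifs <;> simp_all
        rw [h1]
        refine hN.sum_kirchhoff_le ?_
        simp only [Finset.mem_map, Finset.mem_filter, Function.Embedding.coeFn_mk, not_exists]
        rintro y ⟨⟨-, h⟩, h'⟩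
        exact h h'.symm
    · change 0 ≤ if r x = c y then 0 else K (r x) (c y)
      split_ifs with h
      exacts [le_rfl, kirchhoff_nonneg h]
  have hrow : M = Matrix.of fun x => ∑ o, w x o • arrowRow x o := by
    have hsingle : ∀ x y, ∑ o, w x o * optionSingle o y = w x (some y) := by
      intro x y
      rw [Fintype.sum_option]
      simp [optionSingle, Pi.single_apply]
    ext x y
    rw [Matrix.of_apply, Finset.sum_apply]
    rcases x with a | u
    · have hne : r (Sum.inl a) ≠ c y := by
        rcases y with b | v
        · exact fun e => hIJ a b (Subtype.ext e)
        · exact fun e => v.2 ((show (I a : V) = v from e) ▸ (I a).2)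
      have h1 : ∑ o, (w (Sum.inl a) o • arrowRow (Sum.inl a) o) y = w (Sum.inl a) (some y) :=
        hsingle _ y
      rw [h1]
      change _ = if r (Sum.inl a) = c y then 0 else _
      rw [if_neg hne]
      rcases y with b | v <;> rfl
    · have htot : ∑ o, w (Sum.inr u) o = -K u u := by
        rw [Fintype.sum_option]
        change (-K u u - ∑ y, _) + ∑ y, _ = _
        exact sub_add_cancel _ _
      have h1 : ∑ o, (w (Sum.inr u) o • arrowRow (Sum.inr u) o) y =
          -K u u * (Pi.single (Sum.inr u) 1 : Fin k ⊕ N.interior → ℝ) y -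
            w (Sum.inr u) (some y) := by
        rw [← htot, ← hsingle, Finset.sum_mul, ← Finset.sum_sub_distrib]
        refine Finset.sum_congr rfl fun o _ => ?_
        simp only [arrowRow, Pi.smul_apply, Pi.sub_apply, smul_eq_mul, mul_sub]
      rw [h1]
      change _ = _ - if (u : V) = c y then 0 else K u (c y)
      by_cases hy : y = Sum.inr u
      · subst hy
        simp [M, A, c]
      · have hne : (u : V) ≠ c y := fun e => hy (hc e.symm)
        rw [if_neg hne, Pi.single_eq_of_ne hy, mul_zero, zero_sub]
        rcases y with b | v <;> rfl
  rw [hrow]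
  refine det_sum_arrowRow_nonneg w hw fun φ hφ a b a' b' hab hba hfa hfb => ?_
  have hedge : ∀ x y, φ x = some y → ∃ e, N.ends e = s(r x, c y) := by
    intro x y hxy
    have h1 := hφ x
    rw [hxy] at h1
    change 0 < if r x = c y then 0 else K (r x) (c y) at h1
    split_ifs at h1 with h2
    · exact absurd h1 (lt_irrefl _)
    · exact exists_edge_of_kirchhoff_ne_zero h2 h1.ne'
  -- the vertices that flow into a sink, together with the two ends of the path
  let P : Fin k → Fin k → Set V := fun i j =>
    {(I i : V), (J j : V)} ∪ {v | ∃ t : N.interior, v = t ∧ FlowsTo φ (Sum.inr t) j}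
  have hP : ∀ i j, FlowsTo φ (Sum.inl i) j → N.Connects (P i j) (I i) (J j) := fun i j h =>
    connects_of_flowsTo (r := r) (c := c) (fun _ => rfl) hedge (by simp [P, c])
      (fun t ht => Or.inr ⟨t, rfl, ht⟩) h (by simp [P, r])
  refine hcross a b a' b' hab hba (P a a') (P b b') ?_ (hP _ _ hfa) (hP _ _ hfb)
  have hIv : ∀ {i j}, (I i : V) = I j → i = j := fun h => hI (Subtype.ext h)
  have hJv : ∀ {i j}, (J i : V) = J j → i = j := fun h => hJ (Subtype.ext h)
  rw [Set.disjoint_left]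
  rintro v ((rfl | rfl) | ⟨t, rfl, ht⟩) ((h | h) | ⟨s, h, hs⟩)
  · exact hab.ne (hIv h)
  · exact hIJ _ _ (Subtype.ext h)
  · exact s.2 (h ▸ (I a).2)
  · exact hIJ _ _ (Subtype.ext h.symm)
  · exact hba.ne' (hJv h)
  · exact s.2 (h ▸ (J a').2)
  · exact t.2 (h ▸ (I b).2)
  · exact t.2 ((mem_singleton_iff.1 h) ▸ (J b').2)
  · obtain rfl : t = s := Subtype.ext h
    exact hba.ne' (ht.unique hs)

end Response

end ElectricalNetwork

/-! ### Truncations and their limit -/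

namespace ElectricalNetwork

variable {V E : Type*} {N : ElectricalNetwork V E}

theorem mem_interior_truncation {S : Finset V} {v : V} :
    v ∈ (N.truncation S).interior ↔ v ∈ S ∧ v ∈ N.interior := by
  change ¬ (v ∉ S ∨ v ∈ N.boundary) ↔ v ∈ S ∧ ¬ v ∈ N.boundary
  tauto

theorem kirchhoff_truncation {S : Finset V} {u v : V} (h : u ∈ S ∨ v ∈ S) :
    (N.truncation S).kirchhoff u v = N.kirchhoff u v := by
  unfold kirchhoff
  split_ifs with huv
  · subst huv
    rw [or_self] at h
    congr 1
    refine finsum_mem_eq_of_bijOn (s := {e | u ∈ (N.truncation S).ends e ∧ _})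
      (t := {e | u ∈ N.ends e ∧ ¬ (N.ends e).IsDiag}) Subtype.val
      ⟨fun e he => he, Subtype.val_injective.injOn, fun e he => ?_⟩ fun _ _ => rfl
    exact ⟨⟨e, u, h, he.1⟩, he, rfl⟩
  · refine finsum_mem_eq_of_bijOn (s := {e | (N.truncation S).ends e = s(u, v)})
      (t := {e | N.ends e = s(u, v)}) Subtype.val
      ⟨fun e he => he, Subtype.val_injective.injOn, fun e he => ?_⟩ fun _ _ => rfl
    have he' : N.ends e = s(u, v) := he
    refine ⟨⟨e, ?_⟩, he, rfl⟩
    rcases h with h | h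
    · exact ⟨u, h, he' ▸ Sym2.mem_mk_left u v⟩
    · exact ⟨v, h, he' ▸ Sym2.mem_mk_right u v⟩

theorem LocallyFinite.truncation (hN : N.LocallyFinite) (S : Finset V) :
    (N.truncation S).LocallyFinite := fun v =>
  Set.Finite.preimage (s := {e | v ∈ N.ends e}) Subtype.val_injective.injOn (hN v)

theorem Grounded.truncation (hG : N.Grounded) (S : Finset V) : (N.truncation S).Grounded := by
  intro C hC hint
  obtain ⟨e, u, v, he, hu, hv⟩ := hG C hC fun v hv => (mem_interior_truncation.1 (hint v hv)).2
  exact ⟨⟨e, u, (mem_interior_truncation.1 (hint u hu)).1, he ▸ Sym2.mem_mk_left u v⟩, u, v, he,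
    hu, hv⟩

theorem Connects.of_truncation {S : Finset V} {P : Set V} {u v : V}
    (h : (N.truncation S).Connects P u v) : N.Connects P u v :=
  Relation.ReflTransGen.mono (fun _ _ ⟨h1, h2, e, he⟩ => ⟨h1, h2, e, he⟩) _ _ h

open Classical in
/-- The interior vertices of the truncation at `S`. -/
noncomputable def truncationInterior (N : ElectricalNetwork V E) (S : Finset V) : Finset V :=
  S.filter (· ∈ N.interior)

theorem mem_truncationInterior {S : Finset V} {v : V} :
    v ∈ N.truncationInterior S ↔ v ∈ S ∧ v ∈ N.interior := by
  simp [truncationInterior]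

/-- `exists_potential` for a truncation, in terms of the Kirchhoff matrix of the whole network. -/
theorem LocallyFinite.exists_truncated_potential (hN : N.LocallyFinite) (hG : N.Grounded)
    (j : N.boundary) (S : Finset V) : ∃ x : V → ℝ,
      (∀ v, v ∉ N.truncationInterior S → x v = 0) ∧
      (∀ u ∈ N.truncationInterior S,
        ∑ v ∈ N.truncationInterior S, N.kirchhoff u v * x v = -N.kirchhoff u j) ∧
      ∀ i : N.boundary, (i : V) ∈ S → N.truncatedResponse S i j =
        N.kirchhoff i j + ∑ v ∈ N.truncationInterior S, N.kirchhoff i v * x v := by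
  obtain ⟨x, hx0, hx, hresp⟩ := (hN.truncation S).exists_potential (hG.truncation S)
    ⟨j, Or.inr j.2⟩
  have hT : (N.truncation S).interior.toFinset = N.truncationInterior S := by
    ext v
    rw [Set.mem_toFinset, mem_interior_truncation, mem_truncationInterior]
  rw [hT] at hx hresp
  refine ⟨x, fun v hv => hx0 v ?_, fun u hu => ?_, fun i hi => ?_⟩
  · rwa [mem_interior_truncation, ← mem_truncationInterior]
  · have hu' := mem_truncationInterior.1 hu
    have := hx u (mem_interior_truncation.2 hu')
    simpa only [kirchhoff_truncation (N := N) (Or.inl hu'.1)] using this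
  · have := hresp ⟨i, Or.inr i.2⟩
    change (N.truncation S).response ⟨i, Or.inr i.2⟩ ⟨j, Or.inr j.2⟩ = _
    simpa only [kirchhoff_truncation (N := N) (Or.inl hi)] using this

/-- The response matrices of the truncations converge: the potentials in the truncations are
bounded by one and increase with the truncation, by the minimum principle. -/
theorem LocallyFinite.tendsto_truncatedResponse (hN : N.LocallyFinite) (hG : N.Grounded)
    (i j : N.boundary) :
    Tendsto (fun S => N.truncatedResponse S i j) atTop (𝓝 (N.limitResponse i j)) := by
  classical
  choose x hx0 hx hresp using hN.exists_truncated_potential hG j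
  have hint : ∀ S, ∀ v ∈ N.truncationInterior S, v ∈ N.interior := fun S v hv =>
    (mem_truncationInterior.1 hv).2
  have hj : ∀ S, (j : V) ∉ N.truncationInterior S := fun S h => hint S j h j.2
  have hnonneg : ∀ S v, 0 ≤ x S v := by
    intro S v
    by_cases hv : v ∈ N.truncationInterior S
    · refine hN.nonneg_of_superharmonic hG (hint S) (x S) (fun u hu => ?_) v hv
      rw [hx S u hu, neg_nonpos]
      refine kirchhoff_nonneg ?_
      rintro rfl
      exact hj S hu
    · exact (hx0 S v hv).ge
  have hle : ∀ S v, x S v ≤ 1 := by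
    intro S v
    by_cases hv : v ∈ N.truncationInterior S
    · refine sub_nonneg.1 (hN.nonneg_of_superharmonic hG (hint S) (fun v => 1 - x S v)
        (fun u hu => ?_) v hv)
      simp only [mul_sub, mul_one, Finset.sum_sub_distrib, hx S u hu]
      have h1 := hN.sum_kirchhoff_le (u := u)
        (W := insert (j : V) ((N.truncationInterior S).erase u)) (by
          rw [Finset.mem_insert, not_or]
          exact ⟨fun e => hj S (e ▸ hu), Finset.notMem_erase _ _⟩)
      rw [Finset.sum_insert fun h => hj S (Finset.mem_of_mem_erase h)] at h1
      rw [← Finset.add_sum_erase _ _ hu]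
      linarith
    · rw [hx0 S v hv]
      exact zero_le_one
  have hmono : ∀ v, Monotone fun S => x S v := by
    intro v S S' hSS
    by_cases hv : v ∈ N.truncationInterior S
    · have hsub : N.truncationInterior S ⊆ N.truncationInterior S' := fun u hu => by
        rw [mem_truncationInterior] at hu ⊢
        exact ⟨hSS hu.1, hu.2⟩
      refine sub_nonneg.1 (hN.nonneg_of_superharmonic hG (hint S) (fun v => x S' v - x S v)
        (fun u hu => ?_) v hv)
      simp only [mul_sub, Finset.sum_sub_distrib, hx S u hu]
      have h1 := hx S' u (hsub hu)
      rw [← Finset.sum_sdiff hsub] at h1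
      have h2 : 0 ≤ ∑ v ∈ N.truncationInterior S' \ N.truncationInterior S,
          N.kirchhoff u v * x S' v := by
        refine Finset.sum_nonneg fun v hv => mul_nonneg (kirchhoff_nonneg ?_) (hnonneg _ _)
        rintro rfl
        exact (Finset.mem_sdiff.1 hv).2 hu
      linarith
    · change x S v ≤ x S' v
      rw [hx0 S v hv]
      exact hnonneg _ _
  obtain ⟨B, hiB, hB, -⟩ := hN.exists_neighbours (i : V)
  have hev : ∀ᶠ S in atTop, N.kirchhoff i j + ∑ v ∈ B, N.kirchhoff i v * x S v =
      N.truncatedResponse S i j := by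
    filter_upwards [eventually_ge_atTop {(i : V)}] with S hS
    rw [hresp S i (hS (Finset.mem_singleton_self _))]
    congr 1
    have hi : (i : V) ∉ N.truncationInterior S := fun h => hint S i h i.2
    calc ∑ v ∈ B, N.kirchhoff i v * x S v
        = ∑ v ∈ B ∪ N.truncationInterior S, N.kirchhoff i v * x S v := by
          refine Finset.sum_subset Finset.subset_union_left fun v hv hvB => ?_
          have hvi : v ≠ i := by
            rintro rfl
            exact (Finset.mem_union.1 hv).elim hiB hi
          rw [hB v hvi hvB, zero_mul]
      _ = ∑ v ∈ N.truncationInterior S, N.kirchhoff i v * x S v := by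
          refine (Finset.sum_subset Finset.subset_union_right fun v _ hv => ?_).symm
          rw [hx0 S v hv, mul_zero]
  have hconv : Tendsto (fun S => N.kirchhoff i j + ∑ v ∈ B, N.kirchhoff i v * x S v) atTop
      (𝓝 (N.kirchhoff i j + ∑ v ∈ B, N.kirchhoff i v * ⨆ S, x S v)) :=
    tendsto_const_nhds.add <| tendsto_finsetSum _ fun v _ =>
      (tendsto_atTop_ciSup (hmono v) ⟨1, by rintro _ ⟨S, rfl⟩; exact hle S v⟩).const_mul _
  have h := hconv.congr' hev
  have hlim : N.limitResponse i j = _ := h.limUnder_eq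
  rwa [hlim]

/-- Minors of the limit response matrix are nonnegative if no two vertex-disjoint paths of the
network connect the row labels to the column labels in crossing order. -/
theorem LocallyFinite.det_limitResponse_nonneg (hN : N.LocallyFinite) (hG : N.Grounded) {k : ℕ}
    (I J : Fin k → N.boundary) (hI : Function.Injective I) (hJ : Function.Injective J)
    (hIJ : ∀ a b, I a ≠ J b)
    (hcross : ∀ a b c d : Fin k, a < b → d < c → ∀ P Q : Set V, Disjoint P Q →
      N.Connects P (I a) (J c) → N.Connects Q (I b) (J d) → False) :
    0 ≤ (N.limitResponse.submatrix I J).det := by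
  classical
  have hlim : Tendsto (fun S => ((N.truncatedResponse S).submatrix I J).det) atTop
      (𝓝 (N.limitResponse.submatrix I J).det) := by
    refine (continuous_id.matrix_det.tendsto _).comp ?_
    exact tendsto_pi_nhds.2 fun a => tendsto_pi_nhds.2 fun b =>
      hN.tendsto_truncatedResponse hG (I a) (J b)
  refine ge_of_tendsto' hlim fun S => ?_
  have hinc : ∀ {v w : N.boundary}, (⟨v, Or.inr v.2⟩ : (N.truncation S).boundary) =
      ⟨w, Or.inr w.2⟩ → v = w := fun h => Subtype.ext (Subtype.mk.inj h)
  exact (hN.truncation S).det_response_nonneg (hG.truncation S)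
    (fun a => ⟨I a, Or.inr (I a).2⟩) (fun b => ⟨J b, Or.inr (J b).2⟩)
    (fun a b h => hI (hinc h)) (fun a b h => hJ (hinc h)) (fun a b h => hIJ a b (hinc h))
    fun a b c d hab hdc P Q hPQ h h' =>
      hcross a b c d hab hdc P Q hPQ h.of_truncation h'.of_truncation

end ElectricalNetwork

/-! ### The universal cover of a cylindrical network -/

namespace CylindricalNetwork

variable {V E : Type*} {G : CylindricalNetwork V E}

/-- The universal cover satisfies unique path lifting. -/
theorem eq_of_stripProj_eq {p q : C(unitInterval, Strip)}
    (h : ∀ t, stripProj (p t) = stripProj (q t)) {t₀ : unitInterval} (h₀ : p t₀ = q t₀) :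
    p = q := by
  have h1 : (fun t => (p t).1) = fun t => (q t).1 :=
    (AddCircle.isCoveringMap_coe (1 : ℝ)).eq_of_comp_eq (by fun_prop) (by fun_prop)
      (funext fun t => congrArg Prod.fst (h t)) t₀ (congrArg Prod.fst h₀)
  ext1 t
  exact Prod.ext (congrFun h1 t) (congrArg (fun z : Cylinder => z.2) (h t))

theorem coverEdge_eq {e e' : G.CoverEdge} (hE : e.1.1 = e'.1.1) {t : unitInterval}
    (ht : e.1.2 t = e'.1.2 t) : e = e' :=
  Subtype.ext (Prod.ext hE (eq_of_stripProj_eq (fun s => by rw [e.2, e'.2, hE]) ht))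

theorem mem_ends_cover {e : G.CoverEdge} {x : G.CoverVertex} :
    x ∈ G.cover.ends e ↔ e.1.2 0 = x.1 ∨ e.1.2 1 = x.1 := by
  change x ∈ s(G.coverSource e, G.coverTarget e) ↔ _
  rw [Sym2.mem_iff]
  exact or_congr ⟨fun h => (congrArg Subtype.val h).symm, fun h => Subtype.ext h.symm⟩
    ⟨fun h => (congrArg Subtype.val h).symm, fun h => Subtype.ext h.symm⟩

/-- A lifted edge is determined by the edge below and one of its ends. -/
theorem locallyFinite_cover [Finite E] : G.cover.LocallyFinite := by
  intro x
  have h (s : unitInterval) : {e : G.CoverEdge | e.1.2 s = x.1}.Finite :=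
    Set.Finite.of_injOn (f := fun e : G.CoverEdge => e.1.1) (t := univ) (mapsTo_univ _ _)
      (fun e he e' he' hee => coverEdge_eq hee
        ((show e.1.2 s = x.1 from he).trans (show e'.1.2 s = x.1 from he').symm)) finite_univ
  refine ((h 0).union (h 1)).subset fun e he => ?_
  exact mem_ends_cover.1 he

/-- The part of the strip covered by a set of vertices and the edges between them. -/
def region (P : Set G.CoverVertex) : Set Strip :=
  {z | (∃ v ∈ P, v.1 = z) ∨
    ∃ e : G.CoverEdge, (∀ v ∈ G.cover.ends e, v ∈ P) ∧ ∃ t ∈ Ioo (0 : unitInterval) 1, e.1.2 t = z}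

theorem joinedIn_region {P : Set G.CoverVertex} {u v : G.CoverVertex} (hu : u ∈ P)
    (h : G.cover.Connects P u v) : JoinedIn (region P) u.1 v.1 := by
  induction h with
  | refl => exact JoinedIn.refl (Or.inl ⟨u, hu, rfl⟩)
  | @tail v w _ h ih =>
    refine ih.trans ?_
    obtain ⟨hv, hw, e, he⟩ := h
    have hends : ∀ x ∈ G.cover.ends e, x ∈ P := by
      rw [he]
      intro x hx
      rcases Sym2.mem_iff.1 hx with rfl | rfl
      exacts [hv, hw]
    have hmem : ∀ t, e.1.2 t ∈ region P := by
      intro t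
      rcases eq_or_lt_of_le t.2.1 with h0 | h0
      · obtain rfl : t = 0 := Subtype.ext h0.symm
        exact Or.inl ⟨G.coverSource e, hends _ (Sym2.mem_mk_left _ _), rfl⟩
      rcases eq_or_lt_of_le t.2.2 with h1 | h1
      · obtain rfl : t = 1 := Subtype.ext h1
        exact Or.inl ⟨G.coverTarget e, hends _ (Sym2.mem_mk_right _ _), rfl⟩
      exact Or.inr ⟨e, hends, t, ⟨h0, h1⟩, rfl⟩
    have hjoin : JoinedIn (region P) (e.1.2 0) (e.1.2 1) :=
      ⟨⟨e.1.2, rfl, rfl⟩, hmem⟩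
    have he' : s(G.coverSource e, G.coverTarget e) = s(v, w) := he
    rcases Sym2.eq_iff.1 he' with ⟨rfl, rfl⟩ | ⟨rfl, rfl⟩
    exacts [hjoin, hjoin.symm]

/-- Disjoint sets of vertices cover disjoint parts of the strip, as the lifted network is
embedded. -/
theorem disjoint_region {P Q : Set G.CoverVertex} (h : Disjoint P Q) :
    Disjoint (region P) (region Q) := by
  have vertex_edge : ∀ (v : G.CoverVertex) (e : G.CoverEdge), ∀ t ∈ Ioo (0 : unitInterval) 1,
      v.1 = e.1.2 t → False := by
    intro v e t ht hv
    obtain ⟨w, hw⟩ := v.2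
    refine G.arc_ne_pos e.1.1 t ht w ?_
    rw [hw, hv, e.2]
  rw [Set.disjoint_left] at h ⊢
  rintro z (⟨v, hv, rfl⟩ | ⟨e, he, t, ht, rfl⟩) (⟨w, hw, hz⟩ | ⟨e', he', t', ht', hz⟩)
  · obtain rfl : w = v := Subtype.ext hz
    exact h hv hw
  · exact vertex_edge v e' t' ht' hz.symm
  · exact vertex_edge w e t ht hz
  · have hz' : G.arc e'.1.1 t' = G.arc e.1.1 t := by rw [← e.2, ← e'.2, hz]
    have hE : e'.1.1 = e.1.1 := by
      by_contra hne
      exact G.arc_disjoint _ _ hne t' ht' t ht hz'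
    obtain rfl : t' = t := G.arc_injOn e.1.1 ht' ht (hE ▸ hz')
    obtain rfl := coverEdge_eq hE hz
    exact h (he _ (Sym2.mem_mk_left _ _)) (he' _ (Sym2.mem_mk_left _ _))

theorem not_connects_crossing {a b c d : G.cover.boundary} (hab : G.BoundaryBefore a b)
    (hbc : G.BoundaryBefore b c) (hcd : G.BoundaryBefore c d) {P Q : Set G.CoverVertex}
    (hPQ : Disjoint P Q) (ha : (a : G.CoverVertex) ∈ P) (hb : (b : G.CoverVertex) ∈ Q)
    (hac : G.cover.Connects P a c) (hbd : G.cover.Connects Q b d) : False :=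
  not_disjoint_of_crossing (X := region P) (Y := region Q) (show StripBefore a.1.1 b.1.1 from hab)
    hbc hcd (joinedIn_region ha hac) (joinedIn_region hb hbd) (disjoint_region hPQ)

end CylindricalNetwork

/-! ### Cylindrical pairs -/

section CylindricalPair

variable {ι : Type*} [LinearOrder ι] {k : ℕ} {I J : Fin k → ι}

theorem IsCylindricalPair.nodup (h : IsCylindricalPair I J) :
    (List.ofFn I ++ (List.ofFn J).reverse).Nodup := by
  obtain ⟨l, hl, hs⟩ := h
  exact hl.perm.nodup_iff.1 (hs.imp fun h => h.ne)

/-- A cyclic permutation of a sublist of a list is a sublist of a cyclic permutation of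
the list. -/
theorem List.IsRotated.exists_isRotated_sublist {α : Type*} {l l' s : List α} (h : l.IsRotated l')
    (hs : s.Sublist l') : ∃ s' : List α, s'.IsRotated s ∧ s'.Sublist l := by
  obtain ⟨n, hn, rfl⟩ := List.isRotated_iff_mod.1 h
  rw [List.rotate_eq_drop_append_take hn] at hs
  obtain ⟨s₁, s₂, rfl, h₁, h₂⟩ := List.sublist_append_iff.1 hs
  refine ⟨s₂ ++ s₁, List.isRotated_append, ?_⟩
  simpa using h₂.append h₁

/-- In a cylindrical pair, labels of rows `a < b` and columns `d < c` occur in the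
cyclic order `I a`, `I b`, `J c`, `J d`. -/
theorem IsCylindricalPair.cyclic_order (h : IsCylindricalPair I J) {a b c d : Fin k} (hab : a < b)
    (hdc : d < c) :
    (I a < I b ∧ I b < J c ∧ J c < J d) ∨ (I b < J c ∧ J c < J d ∧ J d < I a) ∨
      (J c < J d ∧ J d < I a ∧ I a < I b) ∨ (J d < I a ∧ I a < I b ∧ I b < J c) := by
  obtain ⟨l, hl, hs⟩ := h
  have sub (f : Fin k → ι) {i j : Fin k} (hij : i < j) : [f i, f j].Sublist (List.ofFn f) := by
    simpa using List.map_getElem_sublist (l := List.ofFn f)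
      (is := [i.cast (by simp), j.cast (by simp)]) (by simpa using hij)
  obtain ⟨s, hsr, hsl⟩ := hl.exists_isRotated_sublist
    (s := [I a, I b, J c, J d]) ((sub I hab).append (sub J hdc).reverse)
  have hsort := hs.sublist hsl
  obtain ⟨n, hn, rfl⟩ := List.isRotated_iff_mod.1 hsr.symm
  simp only [List.length_cons, List.length_nil] at hn
  interval_cases n <;> simp at hsort <;> tauto

end CylindricalPair

/-! ### The universal response matrix -/

/-- For a finite cylindrical network, the limits that define the universal response matrix exist
(along every exhausting sequence of truncations), and the universal response matrix is
cylindrically totally nonnegative. The order-preserving labelling `lab` of the boundary vertices of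
the universal cover is arbitrary; if both boundary circles carry boundary vertices, `ι` can be taken
to be `ℤ ∪ ℤ'`, that is, `ℤ ⊕ₗ ℤᵒᵈ`. -/
theorem propositionP {V E : Type*} [Finite V] [Finite E] (G : CylindricalNetwork V E)
    (hG : G.cover.Grounded) {ι : Type*} [LinearOrder ι] (lab : ι ≃ G.cover.boundary)
    (hlab : ∀ a b : ι, a < b ↔ G.BoundaryBefore (lab a) (lab b)) :
    (∀ S : ℕ → Finset G.CoverVertex, Monotone S → (∀ v, ∃ n, v ∈ S n) →
      ∀ i j : G.cover.boundary, Tendsto (fun n => G.cover.truncatedResponse (S n) i j) atTop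
        (𝓝 (G.universalResponse i j))) ∧
    IsCylindricallyTNN (G.universalResponse.submatrix lab lab) := by
  have hfin : G.cover.LocallyFinite := CylindricalNetwork.locallyFinite_cover
  refine ⟨fun S hS hcover i j => (hfin.tendsto_truncatedResponse hG i j).comp
    (tendsto_atTop_finset_of_monotone hS hcover), fun k I J hIJ => ?_⟩
  have hnodup := hIJ.nodup
  rw [List.nodup_append, List.nodup_reverse, List.nodup_ofFn, List.nodup_ofFn] at hnodup
  obtain ⟨hI, hJ, hdisj⟩ := hnodup
  have hne : ∀ a b, I a ≠ J b := fun a b =>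
    hdisj _ (by simp) _ (by simp)
  have hval : ∀ {x y : ι}, x ≠ y → (lab x : G.CoverVertex) ≠ lab y := fun h e =>
    h (lab.injective (Subtype.ext e))
  refine hfin.det_limitResponse_nonneg hG (fun a => lab (I a)) (fun b => lab (J b))
    (lab.injective.comp hI) (lab.injective.comp hJ) (fun a b h => hne a b (lab.injective h)) ?_
  intro a b c d hab hdc P Q hPQ hac hbd
  have ha := hac.left_mem (hval (hne a c))
  have hc := hac.symm.left_mem (hval (hne a c).symm)
  have hb := hbd.left_mem (hval (hne b d))
  have hd := hbd.symm.left_mem (hval (hne b d).symm)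
  rcases hIJ.cyclic_order hab hdc with ⟨h1, h2, h3⟩ | ⟨h1, h2, h3⟩ | ⟨h1, h2, h3⟩ | ⟨h1, h2, h3⟩ <;>
    rw [hlab] at h1 h2 h3
  · exact CylindricalNetwork.not_connects_crossing h1 h2 h3 hPQ ha hb hac hbd
  · exact CylindricalNetwork.not_connects_crossing h1 h2 h3 hPQ.symm hb hc hbd hac.symm
  · exact CylindricalNetwork.not_connects_crossing h1 h2 h3 hPQ hc hd hac.symm hbd.symm
  · exact CylindricalNetwork.not_connects_crossing h1 h2 h3 hPQ.symm hd ha hbd.symm hac
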